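/- Let $X$ be a compact metrizable space, and consider on $X$ a topological dynamical system of one of two kinds: either a continuous action $\phi$ of a topological group, or of a topological semigroup with identity, $G$ on $X$ (so $\phi_1=\mathrm{id}_X$ and $\phi_{\gamma'}\circ\phi_\gamma=\phi_{\gamma'\gamma}$), in which case a Borel probability measure $\mu$ on $X$ is called invariant if $\mu(\phi_\gamma^{-1}A)=\mu(A)$ for all $\gamma\in G$ and all Borel sets $A$; or an upper semicontinuous multivalued map $T$ from $X$ to the closed (possibly empty) subsets of $X$, in which case $\mu$ is called invariant if $\mu(A)\le\mu(T^{-1}A)$ for all Borel sets $A$, where $T^{-1}A=\{x: T(x)\cap A\neq\emptyset\}$. Assume that the set $\mathcal M$ of invariant Borel probability measures is non-empty. Let $V$ be a separable real Banach space that is densely and continuously embedded in the space $C(X)$ of continuous real-valued functions on $X$ with the supremum norm. For $f\in V$ let $\beta(f)=\sup_{\mu\in\mathcal M}\int f\,d\mu$, and call $\mu\in\mathcal M$ $f$-maximizing if $\int f\,d\mu=\beta(f)$. A hypersurface (also called a delta-convex or (c-c) hypersurface) in $V$ is a set of the form $\{f+(\varphi(f)-\psi(f))g : f\in W\}$, where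 $W$ is a closed subspace of $V$ of codimension one, $g\in V\setminus W$ (so that $V=W+\mathbb R g$), and $\varphi,\psi:V\to\mathbb R$ are Lipschitz continuous convex functions. Then the set of those $f\in V$ that do not have a unique maximizing measure can be covered by countably many hypersurfaces. Moreover, the supremum defining $\beta(f)$ is attained for every $f\in V$ (so that every $f\in V$ has a maximizing measure), the function $\beta:V\to\mathbb R$ is convex and Lipschitz continuous, and $f\in V$ has a unique maximizing measure if and only if $\beta$ is Gateaux differentiable at $f$, that is, there is a bounded linear functional $L$ on $V$ such that for each $g\in V$ the two-sided derivative of $t\mapsto\beta(f+tg)$ at $t=0$ exists and equals $L(g)$. -/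

import Mathlib

open MeasureTheory

universe u v w

/-- A (general) topological dynamical system on `X`: either a continuous (left) action on `X` of a
topological group or semigroup with identity, or an upper semicontinuous multivalued map
`T : X → 2 ^ X` with closed, possibly empty, values. -/
inductive TopologicalDynamicalSystem (X : Type u) [TopologicalSpace X] : Type (max u (v + 1))
  | action (G : Type v) [TopologicalSpace G] [Monoid G] [ContinuousMul G]
      [MulAction G X] [ContinuousSMul G X] : TopologicalDynamicalSystem X
  | multivalued (T : X → Set X) (isClosed : ∀ x, IsClosed (T x))
      (usc : UpperHemicontinuous T) : TopologicalDynamicalSystem X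

namespace TopologicalDynamicalSystem

variable {X : Type u} [TopologicalSpace X] [MeasurableSpace X] [BorelSpace X]

/-- The set of invariant Borel probability measures. For an action, `μ (φ_γ⁻¹ A) = μ A` for all
`γ` and all Borel sets `A`; for a multivalued map, `μ A ≤ μ (T⁻¹ A)` for all Borel sets `A`, where
`T⁻¹ A` is the set of those `x` for which `T x` meets `A`. -/
def invariantMeasures : TopologicalDynamicalSystem.{u, v} X → Set (ProbabilityMeasure X)
  | action G => {μ | ∀ γ : G, ∀ A : Set X, MeasurableSet A →
      (μ : Measure X) ((fun x : X => γ • x) ⁻¹' A) = (μ : Measure X) A}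
  | multivalued T _ _ => {μ | ∀ A : Set X, MeasurableSet A →
      (μ : Measure X) A ≤ (μ : Measure X) {x | (T x ∩ A).Nonempty}}

/-- The set of all integrals of `f` against invariant measures. -/
def invariantIntegrals (S : TopologicalDynamicalSystem.{u, v} X) (f : C(X, ℝ)) : Set ℝ :=
  {r | ∃ ν ∈ S.invariantMeasures, r = ∫ x, f x ∂(ν : Measure X)}

/-- The maximum ergodic average `β(f)`. -/
noncomputable def maxErgodicAverage (S : TopologicalDynamicalSystem.{u, v} X) (f : C(X, ℝ)) : ℝ :=
  sSup (S.invariantIntegrals f)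

/-- The set of `f`-maximizing measures. -/
def maximizingMeasures (S : TopologicalDynamicalSystem.{u, v} X) (f : C(X, ℝ)) :
    Set (ProbabilityMeasure X) :=
  {μ | μ ∈ S.invariantMeasures ∧ ∫ x, f x ∂(μ : Measure X) = S.maxErgodicAverage f}

end TopologicalDynamicalSystem

section BanachSpace

variable {V : Type w} [NormedAddCommGroup V] [NormedSpace ℝ V]

/-- A delta-convex, or (c-c), hypersurface of `V`: the graph, in the direction `g`, of the
difference of two Lipschitz convex functions over a closed hyperplane `W` complementary to `g`. -/
def IsDeltaConvexHypersurface (S : Set V) : Prop :=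
  ∃ (W : Submodule ℝ V) (g : V) (φ ψ : V → ℝ),
    IsClosed (W : Set V) ∧ g ∉ W ∧ W ⊔ Submodule.span ℝ {g} = ⊤ ∧
    (∃ K, LipschitzWith K φ) ∧ ConvexOn ℝ Set.univ φ ∧
    (∃ K, LipschitzWith K ψ) ∧ ConvexOn ℝ Set.univ ψ ∧
    S = {h | ∃ f ∈ W, h = f + (φ f - ψ f) • g}

/-- Gateaux differentiability of a real function: all two-sided directional derivatives exist and
they form a bounded linear functional of the direction. -/
def IsGateauxDifferentiableAt (F : V → ℝ) (f : V) : Prop :=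
  ∃ L : V →L[ℝ] ℝ, ∀ g : V, HasLineDerivAt ℝ F (L g) f g

end BanachSpace

/-!
The set of invariant measures is compact in the weak topology: the space of all probability
measures on a compact metrizable space is compact, and invariance is a closed condition
(`TopologicalDynamicalSystem.isCompact_invariantMeasures`). For a multivalued map this rests on the
portmanteau theorem and on the fact that an upper semicontinuous map pulls closed sets back to
closed sets. Hence `β` is a maximum, over a compact set, of linear functionals of norm at most one
on `C(X, ℝ)`, so it is attained, convex and Lipschitz, and each maximizing measure is a subgradient.

Since the image of `V` is dense in `C(X, ℝ)`, a measure is determined by its integrals over `V`.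
If `β` is differentiable at `f`, every maximizing measure has the derivative as its functional, so
there is only one. Conversely, if `μ` is the only maximizing measure of `f`, compactness makes any
choice of maximizing measures of `h` converge to `μ` as `h → f`, and the difference quotients of `β`
are squeezed between the integrals against `μ` and against these measures.

For the covering, let `f` have two maximizing measures. They are separated by an element `g` of a
fixed countable dense set and by rationals `a < b`, so that `a` and `b` are both slopes of supporting
lines of `t ↦ β (f + t g)` at `0`. With `m c v = inf over t of β (v + t g) - c t`, finite for `c = a`
and `c = b`, a point `f = w + s g` of this kind satisfies `β f = m a w + a s = m b w + b s`. Hence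
`s = (m a w - m b w) / (b - a)`, a difference of Lipschitz convex functions of `w`
(`exists_hypersurface_of_kink`). There are countably many triples `(g, a, b)`.
-/

open Filter Topology Set
open scoped NNReal ENNReal

/-! ### Compactness of the set of invariant measures -/

namespace TopologicalDynamicalSystem

variable {X : Type u} [TopologicalSpace X] [MeasurableSpace X] [BorelSpace X]

theorem isClosed_setOf_map_eq [TopologicalSpace.MetrizableSpace X]
    {γ : X → X} (hγ : Continuous γ) :
    IsClosed {μ : ProbabilityMeasure X | ∀ A : Set X, MeasurableSet A →
      (μ : Measure X) (γ ⁻¹' A) = (μ : Measure X) A} := by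
  have h : {μ : ProbabilityMeasure X | ∀ A : Set X, MeasurableSet A →
      (μ : Measure X) (γ ⁻¹' A) = (μ : Measure X) A} =
      {μ | μ.map hγ.measurable.aemeasurable = μ} := by
    ext μ
    constructor
    · intro hμ
      refine ProbabilityMeasure.eq_of_forall_toMeasure_apply_eq _ _ fun A hA => ?_
      rw [ProbabilityMeasure.map_apply' _ _ hA]
      exact hμ A hA
    · intro hμ A hA
      rw [← ProbabilityMeasure.map_apply' μ hγ.measurable.aemeasurable hA]
      exact congrArg (fun ν : ProbabilityMeasure X => (ν : Measure X) A) hμ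
  rw [h]
  exact isClosed_eq (ProbabilityMeasure.continuous_map hγ) continuous_id

/-- The full preimage of a closed set under an upper semicontinuous multivalued map is closed. -/
theorem isClosed_fullPreimage {X : Type u} [TopologicalSpace X] {T : X → Set X} (hT : UpperHemicontinuous T) {K : Set X}
    (hK : IsClosed K) : IsClosed {x | (T x ∩ K).Nonempty} := by
  rw [← isOpen_compl_iff, isOpen_iff_mem_nhds]
  intro x hx
  have hsub : T x ⊆ Kᶜ := by
    rw [subset_compl_iff_disjoint_right, disjoint_iff_inter_eq_empty]
    exact not_nonempty_iff_eq_empty.1 hx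
  filter_upwards [upperHemicontinuous_iff_forall_isOpen.1 hT x Kᶜ hK.isOpen_compl hsub] with y hy
  simp only [mem_compl_iff, mem_ofPred_eq, not_nonempty_iff_eq_empty]
  exact disjoint_iff_inter_eq_empty.1 (subset_compl_iff_disjoint_right.1 hy)

/-- Inner regularity reduces the invariance inequality to closed sets. A closed set `K` is then
enlarged to an open thickening, contained in a closed one, so that both halves of the portmanteau
theorem apply; shrinking the thickenings gives back `K`, because `T x` is compact. -/
theorem isClosed_setOf_le_fullPreimage [CompactSpace X] [TopologicalSpace.MetrizableSpace X]
    {T : X → Set X} (hTc : ∀ x, IsClosed (T x)) (hT : UpperHemicontinuous T) :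
    IsClosed {μ : ProbabilityMeasure X | ∀ A : Set X, MeasurableSet A →
      (μ : Measure X) A ≤ (μ : Measure X) {x | (T x ∩ A).Nonempty}} := by
  let := TopologicalSpace.metrizableSpaceMetric X
  set M := {μ : ProbabilityMeasure X | ∀ A : Set X, MeasurableSet A →
      (μ : Measure X) A ≤ (μ : Measure X) {x | (T x ∩ A).Nonempty}} with hM
  refine isClosed_of_closure_subset fun μ hμ => ?_
  have : (𝓝[M] μ).NeBot := mem_closure_iff_nhdsWithin_neBot.1 hμ
  have hlim : Tendsto (fun ν : ProbabilityMeasure X => ν) (𝓝[M] μ) (𝓝 μ) := nhdsWithin_le_nhds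
  have hthick : ∀ K : Set X, ∀ ε > 0, (μ : Measure X) K ≤
      (μ : Measure X) {x | (T x ∩ Metric.cthickening ε K).Nonempty} := by
    intro K ε hε
    calc (μ : Measure X) K ≤ (μ : Measure X) (Metric.thickening ε K) :=
          measure_mono (Metric.self_subset_thickening hε K)
      _ ≤ liminf (fun ν : ProbabilityMeasure X => (ν : Measure X) (Metric.thickening ε K))
            (𝓝[M] μ) :=
          ProbabilityMeasure.le_liminf_measure_open_of_tendsto hlim Metric.isOpen_thickening
      _ ≤ liminf (fun ν : ProbabilityMeasure X =>
            (ν : Measure X) {x | (T x ∩ Metric.cthickening ε K).Nonempty}) (𝓝[M] μ) := by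
          refine liminf_le_liminf ?_
          filter_upwards [self_mem_nhdsWithin] with ν hν
          exact (measure_mono (Metric.thickening_subset_cthickening ε K)).trans
            (hν _ Metric.isClosed_cthickening.measurableSet)
      _ ≤ limsup (fun ν : ProbabilityMeasure X =>
            (ν : Measure X) {x | (T x ∩ Metric.cthickening ε K).Nonempty}) (𝓝[M] μ) :=
          liminf_le_limsup
      _ ≤ (μ : Measure X) {x | (T x ∩ Metric.cthickening ε K).Nonempty} :=
          ProbabilityMeasure.limsup_measure_closed_le_of_tendsto hlim
            (isClosed_fullPreimage hT Metric.isClosed_cthickening)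
  have hclosed : ∀ K : Set X, IsClosed K →
      (μ : Measure X) K ≤ (μ : Measure X) {x | (T x ∩ K).Nonempty} := by
    intro K hK
    let F : ℕ → Set X := fun n => {x | (T x ∩ Metric.cthickening (1 / ((n : ℝ) + 1)) K).Nonempty}
    have hanti : Antitone F := fun m n hmn x hx =>
      hx.mono (inter_subset_inter_right _
        (Metric.cthickening_mono (Nat.one_div_le_one_div hmn) K))
    have hinter : ⋂ n, F n = {x | (T x ∩ K).Nonempty} := by
      refine Subset.antisymm (fun x hx => ?_) (subset_iInter fun n x hx =>
        hx.mono (inter_subset_inter_right _ (Metric.self_subset_cthickening K)))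
      by_contra hne
      have hdisj : Disjoint (T x) K :=
        disjoint_iff_inter_eq_empty.2 (not_nonempty_iff_eq_empty.1 hne)
      obtain ⟨δ, hδ, hδd⟩ := hdisj.exists_cthickenings (hTc x).isCompact hK
      obtain ⟨n, hn⟩ := exists_nat_one_div_lt hδ
      obtain ⟨y, hyT, hyK⟩ := mem_iInter.1 hx n
      exact disjoint_left.1 hδd (Metric.self_subset_cthickening _ hyT)
        (Metric.cthickening_mono hn.le K hyK)
    have htend : Tendsto (fun n => (μ : Measure X) (F n)) atTop
        (𝓝 ((μ : Measure X) (⋂ n, F n))) :=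
      tendsto_measure_iInter_atTop (fun n =>
        (isClosed_fullPreimage hT Metric.isClosed_cthickening).measurableSet.nullMeasurableSet)
        hanti ⟨0, measure_ne_top _ _⟩
    rw [hinter] at htend
    exact ge_of_tendsto' htend fun n => hthick K _ Nat.one_div_pos_of_nat
  intro A hA
  rw [hA.measure_eq_iSup_isClosed_of_ne_top (measure_ne_top _ _)]
  exact iSup₂_le fun K hKA => iSup_le fun hK => (hclosed K hK).trans
    (measure_mono fun x hx => hx.mono (inter_subset_inter_right _ hKA))

variable [CompactSpace X] [TopologicalSpace.MetrizableSpace X]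
  (S : TopologicalDynamicalSystem.{u, v} X)

theorem isCompact_invariantMeasures : IsCompact S.invariantMeasures := by
  refine IsClosed.isCompact ?_
  cases S with
  | action G =>
    have : invariantMeasures (action G : TopologicalDynamicalSystem.{u, v} X) =
        ⋂ γ : G, {μ : ProbabilityMeasure X | ∀ A : Set X, MeasurableSet A →
          (μ : Measure X) ((fun x : X => γ • x) ⁻¹' A) = (μ : Measure X) A} := by
      ext μ
      simp [invariantMeasures]
    rw [this]
    exact isClosed_iInter fun γ => isClosed_setOf_map_eq (continuous_const_smul γ)
  | multivalued T hTc hT => exact isClosed_setOf_le_fullPreimage hTc hT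

/-! ### Integration functionals and the maximum ergodic average -/

/-- Integration against a probability measure, as a bounded linear functional on `C(X, ℝ)`. -/
noncomputable def integralFunctional (μ : ProbabilityMeasure X) : C(X, ℝ) →L[ℝ] ℝ :=
  LinearMap.mkContinuous
    { toFun := fun f => ∫ x, f x ∂(μ : Measure X)
      map_add' := fun f g => integral_add
        (f.continuous.integrable_of_hasCompactSupport (HasCompactSupport.of_compactSpace _))
        (g.continuous.integrable_of_hasCompactSupport (HasCompactSupport.of_compactSpace _))
      map_smul' := fun c f => integral_const_mul c _ } 1 (fun f => by
        simpa using norm_integral_le_of_norm_le_const (μ := (μ : Measure X))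
          (Eventually.of_forall f.norm_coe_le_norm))

theorem integralFunctional_apply (μ : ProbabilityMeasure X) (f : C(X, ℝ)) :
    integralFunctional μ f = ∫ x, f x ∂(μ : Measure X) := rfl

theorem abs_integralFunctional_le (μ : ProbabilityMeasure X) (f : C(X, ℝ)) :
    |integralFunctional μ f| ≤ ‖f‖ := by
  simpa using (integralFunctional μ).le_of_opNorm_le
    (LinearMap.mkContinuous_norm_le _ zero_le_one _) f

theorem continuous_integralFunctional (f : C(X, ℝ)) :
    Continuous fun μ : ProbabilityMeasure X => integralFunctional μ f :=
  ProbabilityMeasure.continuous_integral_continuousMap f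

theorem integralFunctional_injective :
    Function.Injective (integralFunctional : ProbabilityMeasure X → C(X, ℝ) →L[ℝ] ℝ) := by
  intro μ ν h
  refine ProbabilityMeasure.toMeasure_injective
    (ext_of_forall_integral_eq_of_IsFiniteMeasure fun f => ?_)
  exact DFunLike.congr_fun h f.toContinuousMap

variable {S}

theorem isGreatest_maxErgodicAverage (hS : S.invariantMeasures.Nonempty) (f : C(X, ℝ)) :
    IsGreatest (S.invariantIntegrals f) (S.maxErgodicAverage f) := by
  have himage : S.invariantIntegrals f =
      (fun μ => integralFunctional μ f) '' S.invariantMeasures := by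
    ext r
    simp only [invariantIntegrals, mem_ofPred_eq, mem_image, eq_comm (a := r),
      integralFunctional_apply]
  rw [maxErgodicAverage, himage]
  exact (S.isCompact_invariantMeasures.image (continuous_integralFunctional f)).isGreatest_sSup
    (hS.image _)

theorem maximizingMeasures_nonempty (hS : S.invariantMeasures.Nonempty) (f : C(X, ℝ)) :
    (S.maximizingMeasures f).Nonempty := by
  obtain ⟨ν, hν, h⟩ := (isGreatest_maxErgodicAverage hS f).1
  exact ⟨ν, hν, h.symm⟩

theorem integralFunctional_le_maxErgodicAverage {μ : ProbabilityMeasure X}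
    (hμ : μ ∈ S.invariantMeasures) (f : C(X, ℝ)) :
    integralFunctional μ f ≤ S.maxErgodicAverage f :=
  (isGreatest_maxErgodicAverage ⟨μ, hμ⟩ f).2 ⟨μ, hμ, rfl⟩

theorem integralFunctional_eq_of_mem {μ : ProbabilityMeasure X} {f : C(X, ℝ)}
    (hμ : μ ∈ S.maximizingMeasures f) : integralFunctional μ f = S.maxErgodicAverage f :=
  hμ.2

/-- A maximizing measure is a subgradient of the maximum ergodic average. -/
theorem maxErgodicAverage_add_ge {μ : ProbabilityMeasure X} {f : C(X, ℝ)}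
    (hμ : μ ∈ S.maximizingMeasures f) (h : C(X, ℝ)) :
    S.maxErgodicAverage f + integralFunctional μ h ≤ S.maxErgodicAverage (f + h) := by
  rw [← integralFunctional_eq_of_mem hμ, ← map_add]
  exact integralFunctional_le_maxErgodicAverage hμ.1 _

theorem convexOn_maxErgodicAverage (hS : S.invariantMeasures.Nonempty) :
    ConvexOn ℝ univ S.maxErgodicAverage := by
  refine ⟨convex_univ, fun f _ g _ a b ha hb _ => ?_⟩
  obtain ⟨μ, hμ⟩ := maximizingMeasures_nonempty hS (a • f + b • g)
  rw [← integralFunctional_eq_of_mem hμ, map_add, map_smul, map_smul]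
  have hf := integralFunctional_le_maxErgodicAverage hμ.1 f
  have hg := integralFunctional_le_maxErgodicAverage hμ.1 g
  simp only [smul_eq_mul]
  gcongr

theorem lipschitzWith_maxErgodicAverage (hS : S.invariantMeasures.Nonempty) :
    LipschitzWith 1 S.maxErgodicAverage := by
  refine LipschitzWith.of_le_add fun f g => ?_
  obtain ⟨μ, hμ⟩ := maximizingMeasures_nonempty hS f
  have h1 := integralFunctional_le_maxErgodicAverage hμ.1 g
  have h2 := abs_integralFunctional_le μ (f - g)
  rw [map_sub, integralFunctional_eq_of_mem hμ] at h2
  rw [dist_eq_norm]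
  linarith [le_abs_self (S.maxErgodicAverage f - integralFunctional μ g)]

/-- Maximizing measures depend continuously on the function wherever they are unique: by
compactness, every limit of `ν h` as `h → f` is an invariant measure, and it maximizes `f`. -/
theorem tendsto_maximizingMeasure (hS : S.invariantMeasures.Nonempty) {f : C(X, ℝ)}
    {μ : ProbabilityMeasure X} (huniq : ∀ μ' ∈ S.maximizingMeasures f, μ' = μ)
    {ν : C(X, ℝ) → ProbabilityMeasure X} (hν : ∀ h, ν h ∈ S.maximizingMeasures h) :
    Tendsto ν (𝓝 f) (𝓝 μ) := by
  refine tendsto_iff_ultrafilter _ _ _ |>.2 fun U hU => ?_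
  obtain ⟨μ', hμ', hlim⟩ := S.isCompact_invariantMeasures.ultrafilter_le_nhds (U.map ν)
    (le_principal_iff.2 (show ∀ᶠ h in (U : Filter C(X, ℝ)), ν h ∈ S.invariantMeasures from
      Eventually.of_forall fun h => (hν h).1))
  have hlim' : Tendsto ν U (𝓝 μ') := hlim
  suffices hmax : μ' ∈ S.maximizingMeasures f by rwa [huniq μ' hmax] at hlim'
  refine ⟨hμ', tendsto_nhds_unique
    (((continuous_integralFunctional f).tendsto μ').comp hlim') ?_⟩
  have hβ : Tendsto S.maxErgodicAverage U (𝓝 (S.maxErgodicAverage f)) :=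
    ((lipschitzWith_maxErgodicAverage hS).continuous.tendsto f).mono_left hU
  have hdiff : Tendsto (fun h => integralFunctional (ν h) (h - f)) U (𝓝 0) := by
    refine squeeze_zero_norm (fun h => abs_integralFunctional_le (ν h) (h - f)) ?_
    exact (tendsto_iff_norm_sub_tendsto_zero.1 tendsto_id).mono_left hU
  refine Tendsto.congr (fun h => ?_) (by simpa using hβ.sub hdiff)
  simp [integralFunctional_eq_of_mem (hν h)]

end TopologicalDynamicalSystem

/-! ### Delta-convex hypersurfaces from kinks of a convex function -/

section Kinks

variable {V : Type w} [NormedAddCommGroup V] [NormedSpace ℝ V]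

/-- The infimum over the line `v + ℝ g` of `β` minus the linear function of slope `c`. It is only
meaningful when the infimum is finite. -/
noncomputable def tiltedInf (β : V → ℝ) (g : V) (c : ℝ) (v : V) : ℝ :=
  ⨅ t : ℝ, (β (v + t • g) - c * t)

variable {β : V → ℝ} {g : V} {c : ℝ}

/-- Since `β` is Lipschitz, uniformly in the position on the line, finiteness of the infimum on one
line implies finiteness on all parallel lines. -/
theorem bddBelow_tilted {K : ℝ≥0} (hβ : LipschitzWith K β) {f : V}
    (hf : ∀ t : ℝ, β f + c * t ≤ β (f + t • g)) (v : V) :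
    BddBelow (range fun t : ℝ => β (v + t • g) - c * t) := by
  refine ⟨β f - K * dist f v, ?_⟩
  rintro _ ⟨t, rfl⟩
  have h := hβ.le_add_mul (f + t • g) (v + t • g)
  rw [dist_add_right] at h
  have := hf t
  simp only
  linarith

theorem lipschitzWith_tiltedInf {K : ℝ≥0} (hβ : LipschitzWith K β)
    (hbdd : ∀ v, BddBelow (range fun t : ℝ => β (v + t • g) - c * t)) :
    LipschitzWith K (tiltedInf β g c) := by
  refine LipschitzWith.of_le_add_mul K fun v w => ?_
  rw [← sub_le_iff_le_add]
  refine le_ciInf fun t => ?_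
  have h := hβ.le_add_mul (v + t • g) (w + t • g)
  rw [dist_add_right] at h
  have := ciInf_le (hbdd v) t
  rw [tiltedInf]
  linarith

/-- A partial infimum of a jointly convex function is convex. -/
theorem convexOn_tiltedInf (hβ : ConvexOn ℝ univ β)
    (hbdd : ∀ v, BddBelow (range fun t : ℝ => β (v + t • g) - c * t)) :
    ConvexOn ℝ univ (tiltedInf β g c) := by
  refine ⟨convex_univ, fun v _ w _ a b ha hb hab => ?_⟩
  refine le_of_forall_pos_le_add fun ε hε => ?_
  obtain ⟨s, hs⟩ := exists_lt_of_ciInf_lt (lt_add_of_pos_right (tiltedInf β g c v) hε)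
  obtain ⟨t, ht⟩ := exists_lt_of_ciInf_lt (lt_add_of_pos_right (tiltedInf β g c w) hε)
  have h1 := ciInf_le (hbdd (a • v + b • w)) (a * s + b * t)
  have h2 := hβ.2 (mem_univ (v + s • g)) (mem_univ (w + t • g)) ha hb hab
  have h3 : a • v + b • w + (a * s + b * t) • g = a • (v + s • g) + b • (w + t • g) := by module
  simp only [h3] at h1
  simp only [smul_eq_mul] at h2 ⊢
  have h4 := mul_le_mul_of_nonneg_left hs.le ha
  have h5 := mul_le_mul_of_nonneg_left ht.le hb
  have h6 : a * ε + b * ε = ε := by rw [← add_mul, hab, one_mul]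
  change tiltedInf β g c _ ≤ _ at h1
  linarith

/-- If `c` is a subgradient of `β` at `w + s g` in the direction `g`, then the tilted infimum is
attained there. -/
theorem tiltedInf_eq {w : V} {s : ℝ}
    (h : ∀ t : ℝ, β (w + s • g) + c * t ≤ β (w + s • g + t • g)) :
    tiltedInf β g c w = β (w + s • g) - c * s := by
  have hle : ∀ t : ℝ, β (w + s • g) - c * s ≤ β (w + t • g) - c * t := by
    intro t
    have := h (t - s)
    rw [show w + s • g + (t - s) • g = w + t • g by module] at this
    linarith
  exact le_antisymm (ciInf_le ⟨_, forall_mem_range.2 hle⟩ s) (le_ciInf hle)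

theorem isDeltaConvexHypersurface_graph (ℓ : V →L[ℝ] ℝ) (hℓ : ℓ g = 1) {φ ψ : V → ℝ}
    (hφ : ∃ K, LipschitzWith K φ) (hφ' : ConvexOn ℝ univ φ)
    (hψ : ∃ K, LipschitzWith K ψ) (hψ' : ConvexOn ℝ univ ψ) :
    IsDeltaConvexHypersurface
      {h : V | ∃ f ∈ LinearMap.ker (ℓ : V →ₗ[ℝ] ℝ), h = f + (φ f - ψ f) • g} := by
  refine ⟨LinearMap.ker (ℓ : V →ₗ[ℝ] ℝ), g, φ, ψ, ℓ.isClosed_ker, by simp [hℓ], ?_,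
    hφ, hφ', hψ, hψ', rfl⟩
  refine eq_top_iff.2 fun v _ => Submodule.mem_sup.2
    ⟨v - ℓ v • g, by simp [hℓ], ℓ v • g,
      Submodule.smul_mem _ _ (Submodule.mem_span_singleton_self g), sub_add_cancel _ _⟩

/-- The points at which a Lipschitz convex function has both of the distinct slopes `a < b` as
subgradients in the direction `g` lie on one delta-convex hypersurface. On a line `w + ℝ g` the
parameter `s` of such a point satisfies `tiltedInf β g a w + a s = tiltedInf β g b w + b s`, which
determines `s` as a difference of convex functions of `w`. -/
theorem exists_hypersurface_of_kink {K : ℝ≥0} (hβ : LipschitzWith K β)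
    (hconv : ConvexOn ℝ univ β) (hg : g ≠ 0) {a b : ℝ} (hab : a < b) :
    ∃ H : Set V, IsDeltaConvexHypersurface H ∧
      {f : V | ∀ t : ℝ, β f + a * t ≤ β (f + t • g) ∧ β f + b * t ≤ β (f + t • g)} ⊆ H := by
  obtain ⟨ℓ, hℓ⟩ := SeparatingDual.exists_eq_one (R := ℝ) hg
  rcases eq_empty_or_nonempty
    {f : V | ∀ t : ℝ, β f + a * t ≤ β (f + t • g) ∧ β f + b * t ≤ β (f + t • g)} with h0 | ⟨f₀, hf₀⟩
  · rw [h0]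
    exact ⟨_, isDeltaConvexHypersurface_graph ℓ hℓ (φ := fun _ => 0) (ψ := fun _ => 0)
      ⟨0, LipschitzWith.const 0⟩ (convexOn_const 0 convex_univ)
      ⟨0, LipschitzWith.const 0⟩ (convexOn_const 0 convex_univ), empty_subset _⟩
  have hpos : 0 < b - a := sub_pos.2 hab
  have hbdd_a := bddBelow_tilted hβ fun t => (hf₀ t).1
  have hbdd_b := bddBelow_tilted hβ fun t => (hf₀ t).2
  have hlip : ∀ m : V → ℝ, LipschitzWith K m →
      ∃ K', LipschitzWith K' fun v => (b - a)⁻¹ • m v := fun m hm =>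
    ⟨_, (lipschitzWith_smul (b - a)⁻¹).comp hm⟩
  refine ⟨_, isDeltaConvexHypersurface_graph ℓ hℓ
    (hlip _ (lipschitzWith_tiltedInf hβ hbdd_a))
    ((convexOn_tiltedInf hconv hbdd_a).smul (inv_nonneg.2 hpos.le))
    (hlip _ (lipschitzWith_tiltedInf hβ hbdd_b))
    ((convexOn_tiltedInf hconv hbdd_b).smul (inv_nonneg.2 hpos.le)), fun f hf => ?_⟩
  have hf' : f - ℓ f • g + ℓ f • g = f := sub_add_cancel _ _
  refine ⟨f - ℓ f • g, by simp [hℓ], ?_⟩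
  rw [tiltedInf_eq (s := ℓ f) (by simpa only [hf'] using fun t => (hf t).1),
    tiltedInf_eq (s := ℓ f) (by simpa only [hf'] using fun t => (hf t).2), hf', smul_eq_mul,
    smul_eq_mul, ← mul_sub, show β f - a * ℓ f - (β f - b * ℓ f) = (b - a) * ℓ f by ring,
    inv_mul_cancel_left₀ hpos.ne', hf']

end Kinks

/-! ### Uniqueness of the maximizing measure -/

namespace TopologicalDynamicalSystem

variable {X : Type u} [TopologicalSpace X] [MeasurableSpace X] [BorelSpace X] [CompactSpace X]
  [TopologicalSpace.MetrizableSpace X] {S : TopologicalDynamicalSystem.{u, v} X}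
  {V : Type w} [NormedAddCommGroup V] [NormedSpace ℝ V] {ι : V →L[ℝ] C(X, ℝ)}

theorem eq_of_integralFunctional_comp_eq (hdense : DenseRange ι) {μ ν : ProbabilityMeasure X}
    (h : ∀ g : V, integralFunctional μ (ι g) = integralFunctional ν (ι g)) : μ = ν :=
  integralFunctional_injective <| DFunLike.coe_injective <|
    hdense.equalizer (integralFunctional μ).continuous (integralFunctional ν).continuous (funext h)

/-- Two distinct maximizing measures differ on some member of a dense sequence, and their integrals
are two subgradients in that direction, with rational numbers `a < b` between them. -/
theorem exists_kink_of_ne (hdense : DenseRange ι) {d : ℕ → V} (hd : DenseRange d) {f : V}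
    {μ ν : ProbabilityMeasure X} (hμ : μ ∈ S.maximizingMeasures (ι f))
    (hν : ν ∈ S.maximizingMeasures (ι f)) (hne : μ ≠ ν) :
    ∃ (n : ℕ) (a b : ℚ), d n ≠ 0 ∧ (a : ℝ) < b ∧ ∀ t : ℝ,
      S.maxErgodicAverage (ι f) + a * t ≤ S.maxErgodicAverage (ι (f + t • d n)) ∧
      S.maxErgodicAverage (ι f) + b * t ≤ S.maxErgodicAverage (ι (f + t • d n)) := by
  have hex : ∃ n, integralFunctional μ (ι (d n)) ≠ integralFunctional ν (ι (d n)) := by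
    by_contra! h
    refine hne (eq_of_integralFunctional_comp_eq hdense fun g => ?_)
    exact congrFun (hd.equalizer ((integralFunctional μ).continuous.comp ι.continuous)
      ((integralFunctional ν).continuous.comp ι.continuous) (funext h)) g
  obtain ⟨n, hn⟩ := hex
  wlog hlt : integralFunctional μ (ι (d n)) < integralFunctional ν (ι (d n)) generalizing μ ν
  · exact this hν hμ hne.symm hn.symm (lt_of_le_of_ne (not_lt.1 hlt) hn.symm)
  obtain ⟨a, ha1, ha2⟩ := exists_rat_btwn hlt
  obtain ⟨b, hab, hb⟩ := exists_rat_btwn ha2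
  refine ⟨n, a, b, fun h0 => hn (by simp [h0]), hab, fun t => ?_⟩
  have h1 := maxErgodicAverage_add_ge hμ (t • ι (d n))
  have h2 := maxErgodicAverage_add_ge hν (t • ι (d n))
  rw [map_smul, smul_eq_mul] at h1 h2
  rw [map_add, map_smul]
  rcases le_total 0 t with ht | ht
  · constructor <;> nlinarith
  · constructor <;> nlinarith

theorem isGateauxDifferentiableAt_of_unique (hS : S.invariantMeasures.Nonempty) {f : V}
    (huniq : ∃! μ, μ ∈ S.maximizingMeasures (ι f)) :
    IsGateauxDifferentiableAt (fun h : V => S.maxErgodicAverage (ι h)) f := by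
  obtain ⟨μ, hμ, huniq⟩ := huniq
  choose ν hν using maximizingMeasures_nonempty hS
  refine ⟨(integralFunctional μ).comp ι, fun g => ?_⟩
  rw [hasLineDerivAt_iff_tendsto_slope_zero, tendsto_iff_norm_sub_tendsto_zero]
  have hline : Tendsto (fun t : ℝ => ι (f + t • g)) (𝓝[≠] 0) (𝓝 (ι f)) := by
    have : Continuous fun t : ℝ => ι (f + t • g) := by fun_prop
    simpa using (this.tendsto 0).mono_left nhdsWithin_le_nhds
  have hconv : Tendsto (fun t : ℝ => ‖integralFunctional (ν (ι (f + t • g))) (ι g) -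
      integralFunctional μ (ι g)‖) (𝓝[≠] 0) (𝓝 0) :=
    tendsto_iff_norm_sub_tendsto_zero.1 <| ((continuous_integralFunctional (ι g)).tendsto μ).comp
      ((tendsto_maximizingMeasure hS huniq hν).comp hline)
  refine squeeze_zero' (Eventually.of_forall fun t => norm_nonneg _) ?_ hconv
  filter_upwards [self_mem_nhdsWithin] with t ht
  have ht0 : t ≠ 0 := ht
  -- The increment of `β` lies between its values predicted by `μ` and by the maximizing measure
  -- of the perturbed function.
  have h1 := maxErgodicAverage_add_ge hμ (t • ι g)
  have h2 := maxErgodicAverage_add_ge (hν (ι (f + t • g))) (-(t • ι g))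
  rw [show ι (f + t • g) + -(t • ι g) = ι f by simp] at h2
  rw [show ι f + t • ι g = ι (f + t • g) by simp] at h1
  simp only [map_neg, map_smul, smul_eq_mul] at h1 h2
  have hfactor : t⁻¹ • (S.maxErgodicAverage (ι (f + t • g)) - S.maxErgodicAverage (ι f)) -
      ((integralFunctional μ).comp ι) g = t⁻¹ * (S.maxErgodicAverage (ι (f + t • g)) -
      S.maxErgodicAverage (ι f) - t * integralFunctional μ (ι g)) := by
    simp only [smul_eq_mul, ContinuousLinearMap.comp_apply]
    field_simp
  rw [hfactor, norm_mul, norm_inv, inv_mul_le_iff₀ (norm_pos_iff.2 ht0), ← norm_mul,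
    Real.norm_eq_abs, Real.norm_eq_abs]
  exact abs_le_abs_of_nonneg (by linarith) (by linarith)

theorem unique_of_isGateauxDifferentiableAt (hS : S.invariantMeasures.Nonempty)
    (hdense : DenseRange ι) {f : V}
    (hdiff : IsGateauxDifferentiableAt (fun h : V => S.maxErgodicAverage (ι h)) f) :
    ∃! μ, μ ∈ S.maximizingMeasures (ι f) := by
  obtain ⟨L, hL⟩ := hdiff
  -- A linear minorant touching a differentiable function has the same derivative.
  have hslope : ∀ μ ∈ S.maximizingMeasures (ι f), ∀ g : V,
      integralFunctional μ (ι g) = L g := by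
    intro μ hμ g
    have hd : HasDerivAt (fun t : ℝ => S.maxErgodicAverage (ι (f + t • g)) -
        t * integralFunctional μ (ι g)) (L g - 1 * integralFunctional μ (ι g)) 0 :=
      (hL g : HasDerivAt _ _ _).sub ((hasDerivAt_id (0 : ℝ)).mul_const _)
    have hmin : IsLocalMin (fun t : ℝ => S.maxErgodicAverage (ι (f + t • g)) -
        t * integralFunctional μ (ι g)) 0 := by
      refine Eventually.of_forall fun t => ?_
      have h := maxErgodicAverage_add_ge hμ (t • ι g)
      rw [show ι f + t • ι g = ι (f + t • g) by simp, map_smul, smul_eq_mul] at h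
      simp only [zero_smul, add_zero, zero_mul, sub_zero]
      linarith
    have := hmin.hasDerivAt_eq_zero hd
    linarith
  obtain ⟨μ, hμ⟩ := maximizingMeasures_nonempty hS (ι f)
  exact ⟨μ, hμ, fun ν hν => eq_of_integralFunctional_comp_eq hdense fun g =>
    (hslope ν hν g).trans (hslope μ hμ g).symm⟩

end TopologicalDynamicalSystem

open TopologicalDynamicalSystem in
theorem theorem2 {X : Type u} [TopologicalSpace X] [CompactSpace X]
    [TopologicalSpace.MetrizableSpace X] [MeasurableSpace X] [BorelSpace X]
    (S : TopologicalDynamicalSystem.{u, v} X) (hS : S.invariantMeasures.Nonempty)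
    {V : Type w} [NormedAddCommGroup V] [NormedSpace ℝ V] [CompleteSpace V]
    [TopologicalSpace.SeparableSpace V]
    (ι : V →L[ℝ] C(X, ℝ)) (hι : Function.Injective ι) (hdense : DenseRange ι) :
    -- the exceptional set is covered by countably many hypersurfaces
    (∃ 𝓗 : Set (Set V), 𝓗.Countable ∧ (∀ H ∈ 𝓗, IsDeltaConvexHypersurface H) ∧
      {f : V | ∃! μ, μ ∈ S.maximizingMeasures (ι f)}ᶜ ⊆ ⋃₀ 𝓗) ∧
    -- the supremum defining `β` is a maximum
    (∀ f : V, IsGreatest (S.invariantIntegrals (ι f)) (S.maxErgodicAverage (ι f))) ∧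
    -- `β` is convex and Lipschitz
    ConvexOn ℝ Set.univ (fun f : V => S.maxErgodicAverage (ι f)) ∧
    (∃ K, LipschitzWith K (fun f : V => S.maxErgodicAverage (ι f))) ∧
    -- uniqueness of the maximizing measure is Gateaux differentiability of `β`
    (∀ f : V, (∃! μ, μ ∈ S.maximizingMeasures (ι f)) ↔
      IsGateauxDifferentiableAt (fun h : V => S.maxErgodicAverage (ι h)) f) := by
  have hconv : ConvexOn ℝ univ (fun f : V => S.maxErgodicAverage (ι f)) :=
    (convexOn_maxErgodicAverage hS).comp_linearMap (ι : V →ₗ[ℝ] C(X, ℝ))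
  have hlip := (lipschitzWith_maxErgodicAverage hS).comp ι.lipschitz
  refine ⟨?_, fun f => isGreatest_maxErgodicAverage hS (ι f), hconv, ⟨_, hlip⟩,
    fun f => ⟨isGateauxDifferentiableAt_of_unique hS, unique_of_isGateauxDifferentiableAt hS hdense⟩⟩
  let d : ℕ → V := TopologicalSpace.denseSeq V
  let P := {p : ℕ × ℚ × ℚ // d p.1 ≠ 0 ∧ (p.2.1 : ℝ) < p.2.2}
  choose H hH hsub using fun p : P => exists_hypersurface_of_kink hlip hconv p.2.1 p.2.2
  refine ⟨range H, countable_range H, forall_mem_range.2 hH, fun f hf => ?_⟩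
  obtain ⟨μ, hμ⟩ := maximizingMeasures_nonempty hS (ι f)
  have hex : ∃ ν ∈ S.maximizingMeasures (ι f), ν ≠ μ := by
    by_contra! h
    exact hf ⟨μ, hμ, h⟩
  obtain ⟨ν, hν, hne⟩ := hex
  obtain ⟨n, a, b, hn, hab, hk⟩ :=
    exists_kink_of_ne hdense (TopologicalSpace.denseRange_denseSeq V) hν hμ hne
  exact mem_sUnion.2 ⟨_, mem_range_self (⟨(n, a, b), hn, hab⟩ : P), hsub _ hk⟩
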